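/- Let $\Lambda$ be a set and let $\mathcal E_1,\mathcal E_2$ be complex Hilbert spaces. A function $K:\Lambda\times\Lambda\to\mathcal B(\mathcal E)$ is a kernel if $\sum_{p,q}\langle K(x_p,x_q)\eta_q,\eta_p\rangle\ge 0$ for all finite families $x_j\in\Lambda$, $\eta_j\in\mathcal E$; $\mathcal H_K$ denotes the reproducing kernel Hilbert space of $\mathcal E$-valued functions on $\Lambda$ with kernel $K$. A function $\varphi:\Lambda\to\mathcal B(\mathcal E)$ is a multiplier of $\mathcal H_K$, written $\varphi\in\mathcal M(\mathcal H_K)$, if $\varphi f\in\mathcal H_K$ for every $f\in\mathcal H_K$, and then $M^K_\varphi$ denotes the bounded operator $f\mapsto\varphi f$ on $\mathcal H_K$. Let $k_1,k_2$ be scalar-valued kernels on $\Lambda$ such that $k_1(\cdot,\mu)\ne 0$ for every $\mu\in\Lambda$. Put $K_1=k_1I_{\mathcal E_1}$, $K_2=k_2I_{\mathcal E_2}$, and let $K=K_1*K_2$ be the $\mathcal B(\mathcal E_1\otimes\mathcal E_2)$-valued kernel $K(\lambda,\mu)=K_1(\lambda,\mu)\otimes K_2(\lambda,\mu)$, where $\mathcal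 E_1\otimes\mathcal E_2$ is the Hilbert space tensor product. For $\varphi:\Lambda\to\mathcal B(\mathcal E_1)$ write $(\varphi*I)(\lambda)=\varphi(\lambda)\otimes I_{\mathcal E_2}$. (If $\varphi\in\mathcal M(\mathcal H_{K_1})$, then $\varphi*I\in\mathcal M(\mathcal H_K)$.) Let $\sim_{k_1}$ be the equivalence relation on $\Lambda$ for which $\lambda\sim_{k_1}\mu$ if and only if there is a finite chain $\lambda=\lambda_1,\dots,\lambda_m=\mu$ in $\Lambda$, $m\ge 1$, with $k_1(\lambda_j,\lambda_{j+1})\ne 0$ for $1\le j\le m-1$. Suppose that 1. the map $M^{K_1}_\psi\mapsto M^K_{\psi*I}$ from $\mathcal M(\mathcal H_{K_1})$ to $\mathcal M(\mathcal H_K)$ preserves the norm, that is, $\|M^K_{\psi*I}\|=\|M^{K_1}_\psi\|$ for every $\psi\in\mathcal M(\mathcal H_{K_1})$; 2. $\mathcal H_{k_1}\cap\mathcal H_{k_2}$ is dense in $\mathcal H_{k_1}$. Let $\varphi\in\mathcal M(\mathcal H_{K_1})$ be such that $M^K_{\varphi*I}$ is an isometry. Then on each equivalence class $S$ of $\sim_{k_1}$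 the multiplier is a constant isometry: there is a linear isometry $V:\mathcal E_1\to\mathcal E_1$ with $\varphi(\lambda)=V$ for all $\lambda\in S$, and likewise $\varphi*I$ is equal on $S$ to a constant isometry of $\mathcal E_1\otimes\mathcal E_2$. In particular, if $k_1(\lambda,\mu)\ne 0$ for all $\lambda,\mu\in\Lambda$, then any two points of $\Lambda$ are equivalent under $\sim_{k_1}$, and $\varphi$ (and likewise $\varphi*I$) is a constant isometry on $\Lambda$. -/

import Mathlib

open scoped TensorProduct ComplexOrder

noncomputable section

namespace KernelFactorization

/-! ### Multipliers between reproducing kernel Hilbert spaces -/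

section Multipliers

variable {X V₁ V₂ : Type*}
  [NormedAddCommGroup V₁] [InnerProductSpace ℂ V₁] [NormedAddCommGroup V₂] [InnerProductSpace ℂ V₂]
  (H₁ H₂ : Type*)
  [NormedAddCommGroup H₁] [InnerProductSpace ℂ H₁] [RKHS ℂ H₁ X V₁]
  [NormedAddCommGroup H₂] [InnerProductSpace ℂ H₂] [RKHS ℂ H₂ X V₂]

/-- An operator-valued function `φ` is a multiplier from `H₁` to `H₂` if the function
`x ↦ φ x (f x)` belongs to `H₂` for every `f` in `H₁`. -/
def IsMultiplier (φ : X → V₁ →L[ℂ] V₂) : Prop :=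
  ∀ f : H₁, ∃ g : H₂, ∀ x, g x = φ x (f x)

variable {H₁ H₂}

/-- The multiplication operator of a multiplier, as a linear map. -/
def IsMultiplier.linearMap {φ : X → V₁ →L[ℂ] V₂} (hφ : IsMultiplier H₁ H₂ φ) : H₁ →ₗ[ℂ] H₂ where
  toFun f := (hφ f).choose
  map_add' f g := by
    ext x
    rw [(hφ (f + g)).choose_spec x, RKHS.coe_add, RKHS.coe_add, Pi.add_apply, Pi.add_apply,
      (hφ f).choose_spec x, (hφ g).choose_spec x, map_add]
  map_smul' c f := by
    ext x
    rw [(hφ (c • f)).choose_spec x, RingHom.id_apply, RKHS.coe_smul, RKHS.coe_smul, Pi.smul_apply,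
      Pi.smul_apply, (hφ f).choose_spec x, map_smul]

theorem IsMultiplier.linearMap_apply {φ : X → V₁ →L[ℂ] V₂} (hφ : IsMultiplier H₁ H₂ φ)
    (f : H₁) (x : X) : hφ.linearMap f x = φ x (f x) :=
  (hφ f).choose_spec x

variable [CompleteSpace H₁] [CompleteSpace H₂]

theorem IsMultiplier.continuous_linearMap {φ : X → V₁ →L[ℂ] V₂} (hφ : IsMultiplier H₁ H₂ φ) :
    Continuous hφ.linearMap := by
  refine LinearMap.continuous_of_seq_closed_graph _ fun u f g hu hg => ?_
  ext x
  have h₁ := ((RKHS.continuous_eval (𝕜 := ℂ) (H := H₂) x).tendsto g).comp hg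
  have h₂ := (((φ x).continuous.comp (RKHS.continuous_eval (𝕜 := ℂ) (H := H₁) x)).tendsto f).comp hu
  refine tendsto_nhds_unique h₁ ?_
  rw [hφ.linearMap_apply]
  refine h₂.congr fun n => ?_
  simp [hφ.linearMap_apply]

/-- The bounded multiplication operator `M_φ : H₁ → H₂`, `(M_φ f)(x) = φ(x) f(x)`, of a
multiplier `φ`. -/
def IsMultiplier.mulOp {φ : X → V₁ →L[ℂ] V₂} (hφ : IsMultiplier H₁ H₂ φ) : H₁ →L[ℂ] H₂ :=
  ⟨hφ.linearMap, hφ.continuous_linearMap⟩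

theorem IsMultiplier.mulOp_apply {φ : X → V₁ →L[ℂ] V₂} (hφ : IsMultiplier H₁ H₂ φ)
    (f : H₁) (x : X) : hφ.mulOp f x = φ x (f x) :=
  hφ.linearMap_apply f x

end Multipliers

/-! ### Hilbert tensor products -/

section HilbertTensor

variable (E F : Type*)
  [NormedAddCommGroup E] [InnerProductSpace ℂ E] [NormedAddCommGroup F] [InnerProductSpace ℂ F]

/-- The Hilbert space tensor product: the completion of the algebraic tensor product with
respect to the inner product `⟪x ⊗ y, x' ⊗ y'⟫ = ⟪x, x'⟫ * ⟪y, y'⟫`. -/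
abbrev HilbertTensor : Type _ := UniformSpace.Completion (E ⊗[ℂ] F)

variable {E F}
variable {E' F' : Type*} [NormedAddCommGroup E'] [InnerProductSpace ℂ E']
  [NormedAddCommGroup F'] [InnerProductSpace ℂ F']

/-- The tensor product of two bounded operators, acting on the Hilbert space tensor product. -/
def opTensor (A : E →L[ℂ] E') (B : F →L[ℂ] F') : HilbertTensor E F →L[ℂ] HilbertTensor E' F' :=
  (TensorProduct.mapL A B).completion

theorem opTensor_coe (A : E →L[ℂ] E') (B : F →L[ℂ] F') (t : E ⊗[ℂ] F) :
    opTensor A B (t : HilbertTensor E F) =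
      (TensorProduct.mapL A B t : E' ⊗[ℂ] F') :=
  ContinuousLinearMap.completion_apply_coe _ _

end HilbertTensor

/-! ### Kernels -/

section Kernels

variable {Λ : Type*}

/-- An operator-valued function that factors as `K(λ, μ) = Φ(λ)* Φ(μ)` is a kernel. -/
theorem posSemidef_of_factorization {V H : Type*} [NormedAddCommGroup V] [InnerProductSpace ℂ V]
    [CompleteSpace V] [NormedAddCommGroup H] [InnerProductSpace ℂ H]
    {K : Matrix Λ Λ (V →L[ℂ] V)} (Φ : Λ → V →L[ℂ] H)
    (h : ∀ x y v w, inner ℂ (K x y v) w = inner ℂ (Φ y v) (Φ x w)) : K.PosSemidef := by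
  have h₀ := (RKHS.posSemidef_tfae (K := K)).out 0 2
  refine h₀.mpr ⟨?_, fun vv => ?_⟩
  · ext x y v
    refine ext_inner_right ℂ fun w => ?_
    rw [Matrix.conjTranspose_apply, ContinuousLinearMap.star_eq_adjoint,
      ContinuousLinearMap.adjoint_inner_left, h, ← inner_conj_symm, h, inner_conj_symm]
  · have : (vv.sum fun x w => vv.sum fun x' w' => inner ℂ (K x' x w) w') =
        inner ℂ (vv.sum fun x w => Φ x w) (vv.sum fun x w => Φ x w) := by
      simp only [h, Finsupp.sum_inner, Finsupp.inner_sum]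
      exact Finsupp.sum_comm _ _ _
    rw [this]
    exact inner_self_nonneg

/-- The quasiscalar kernel `k I_E` of a scalar kernel `k`. -/
def quasiscalar (k : Matrix Λ Λ ℂ) (E : Type*) [NormedAddCommGroup E] [InnerProductSpace ℂ E] :
    Matrix Λ Λ (E →L[ℂ] E) :=
  Matrix.of fun x y => k x y • ContinuousLinearMap.id ℂ E

/-- The pointwise tensor product `(K₁ * K₂)(λ, μ) = K₁(λ, μ) ⊗ K₂(λ, μ)` of two kernels. -/
def kernelStar {E F : Type*} [NormedAddCommGroup E] [InnerProductSpace ℂ E]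
    [NormedAddCommGroup F] [InnerProductSpace ℂ F]
    (K₁ : Matrix Λ Λ (E →L[ℂ] E)) (K₂ : Matrix Λ Λ (F →L[ℂ] F)) :
    Matrix Λ Λ (HilbertTensor E F →L[ℂ] HilbertTensor E F) :=
  Matrix.of fun x y => opTensor (K₁ x y) (K₂ x y)

/-- The function `(φ * I)(λ) = φ(λ) ⊗ I_F`. -/
def starId {E : Type*} [NormedAddCommGroup E] [InnerProductSpace ℂ E]
    (φ : Λ → E →L[ℂ] E) (F : Type*) [NormedAddCommGroup F] [InnerProductSpace ℂ F] :
    Λ → HilbertTensor E F →L[ℂ] HilbertTensor E F :=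
  fun x => opTensor (φ x) (ContinuousLinearMap.id ℂ F)

/-- `k · 1` is a kernel with values in the operators on `ℂ`. -/
theorem posSemidef_quasiscalar_complex {k : Matrix Λ Λ ℂ} (hk : k.PosSemidef) :
    (quasiscalar k ℂ).PosSemidef := by
  have h₀ := (RKHS.posSemidef_tfae (K := quasiscalar k ℂ)).out 0 2
  refine h₀.mpr ⟨?_, fun vv => ?_⟩
  · ext x y
    refine ext_inner_right ℂ fun w => ?_
    rw [Matrix.conjTranspose_apply, ContinuousLinearMap.star_eq_adjoint,
      ContinuousLinearMap.adjoint_inner_left]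
    have := hk.isHermitian.apply x y
    simp [quasiscalar, ← this, mul_comm]
  · have h := (Complex.nonneg_iff.mp (hk.2 vv)).1
    have e : (vv.sum fun x w => vv.sum fun x' w' => inner ℂ (quasiscalar k ℂ x' x w) w') =
        vv.sum fun x w => vv.sum fun x' w' => star w * k x x' * w' := by
      refine Finsupp.sum_congr fun x _ => Finsupp.sum_congr fun x' _ => ?_
      rw [← hk.isHermitian.apply x x']
      simp [quasiscalar]
      ring
    rw [e]
    exact h

instance fact_quasiscalar_complex {k : Matrix Λ Λ ℂ} [hk : Fact k.PosSemidef] :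
    Fact (quasiscalar k ℂ).PosSemidef :=
  ⟨posSemidef_quasiscalar_complex hk.out⟩

variable {E F : Type*} [NormedAddCommGroup E] [InnerProductSpace ℂ E]
  [NormedAddCommGroup F] [InnerProductSpace ℂ F]

instance fact_quasiscalar [CompleteSpace E] {k : Matrix Λ Λ ℂ} [Fact k.PosSemidef] :
    Fact (quasiscalar k E).PosSemidef := by
  refine ⟨posSemidef_of_factorization (H := RKHS.OfKernel (quasiscalar k ℂ) ⊗[ℂ] E)
    (fun x => TensorProduct.mkL ℂ _ E
      (RKHS.kerFun (RKHS.OfKernel (quasiscalar k ℂ)) x 1)) fun x y v w => ?_⟩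
  rw [TensorProduct.mkL_apply_apply, TensorProduct.mkL_apply_apply, TensorProduct.inner_tmul,
    ← RKHS.kernel_inner, RKHS.OfKernel.kernel_ofKernel]
  simp [quasiscalar, mul_comm]

instance fact_kernelStar [CompleteSpace E] [CompleteSpace F]
    {K₁ : Matrix Λ Λ (E →L[ℂ] E)} {K₂ : Matrix Λ Λ (F →L[ℂ] F)}
    [Fact K₁.PosSemidef] [Fact K₂.PosSemidef] : Fact (kernelStar K₁ K₂).PosSemidef := by
  refine ⟨posSemidef_of_factorization
    (H := HilbertTensor (RKHS.OfKernel K₁) (RKHS.OfKernel K₂))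
    (fun x => opTensor (RKHS.kerFun (RKHS.OfKernel K₁) x) (RKHS.kerFun (RKHS.OfKernel K₂) x))
    fun x y v w => ?_⟩
  induction v using UniformSpace.Completion.induction_on with
  | hp => exact isClosed_eq (by fun_prop) (by fun_prop)
  | ih s =>
    induction w using UniformSpace.Completion.induction_on with
    | hp => exact isClosed_eq (by fun_prop) (by fun_prop)
    | ih t =>
      simp only [kernelStar, Matrix.of_apply, opTensor_coe, UniformSpace.Completion.inner_coe]
      induction s using TensorProduct.induction_on with
      | zero => simp
      | add s s' hs hs' => simp only [map_add, inner_add_left, hs, hs']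
      | tmul a b =>
        induction t using TensorProduct.induction_on with
        | zero => simp
        | add t t' ht ht' => simp only [map_add, inner_add_right, ht, ht']
        | tmul c d =>
          rw [TensorProduct.mapL_tmul, TensorProduct.mapL_tmul, TensorProduct.mapL_tmul,
            TensorProduct.inner_tmul, TensorProduct.inner_tmul, ← RKHS.kernel_inner,
            ← RKHS.kernel_inner, RKHS.OfKernel.kernel_ofKernel, RKHS.OfKernel.kernel_ofKernel]

/-- The relation `λ ∼ μ`: there is a finite chain `λ = λ₁, …, λₘ = μ` with
`k(λⱼ, λⱼ₊₁) ≠ 0` for all `j`. -/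
def kernelSetoid (k : Matrix Λ Λ ℂ) [hk : Fact k.PosSemidef] : Setoid Λ where
  r := Relation.ReflTransGen fun x y => k x y ≠ 0
  iseqv :=
    { refl := fun _ => Relation.ReflTransGen.refl
      symm := by
        have hs : ∀ a b, k a b ≠ 0 → k b a ≠ 0 := fun a b hab => by
          rwa [← hk.out.isHermitian.apply, star_ne_zero]
        intro x y h
        induction h with
        | refl => exact Relation.ReflTransGen.refl
        | tail _ hbc ih => exact ih.head (hs _ _ hbc)
      trans := fun h h' => h.trans h' }

/-- The operator-valued function `φ` is a constant isometry on the set `S`. -/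
def IsConstantIsometryOn (φ : Λ → E →L[ℂ] E) (S : Set Λ) : Prop :=
  ∃ V : E →ₗᵢ[ℂ] E, ∀ x ∈ S, φ x = V.toContinuousLinearMap

end Kernels

end KernelFactorization

end

/-!
The space of `K = K₁ * K₂` embeds isometrically into the Hilbert tensor product of the spaces of
`K₁` and `K₂` by `J : K(·, x)(a ⊗ b) ↦ K₁(·, x)a ⊗ K₂(·, x)b`. The adjoint of `J` is restriction to
the diagonal, `(J* (u ⊗ v))(x) = u(x) ⊗ v(x)`, so `J* (M_φ ⊗ I) = M_{φ * I} J*`.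

By the norm hypothesis `M_φ` is a contraction when `M_{φ * I}` is an isometry. For a vector `h`
this gives `‖J* (M_φ ⊗ I) J h‖ = ‖M_{φ * I} h‖ = ‖h‖ ≥ ‖(M_φ ⊗ I) J h‖`, and since `J` is an isometry
`(M_φ ⊗ I) J h` must lie in the range of `J`. In particular `M_φ k₁(·, μ)a ⊗ k₂(·, μ)b` lies there
(`apply_mulOp_kerFun_of_isometry`), hence is orthogonal to every function of two variables that
vanishes on the diagonal.

For scalar functions `u, v` common to the spaces of `k₁` and `k₂`, the function
`u c ⊗ v b - v c ⊗ u b` is of this kind. Fixing `v` with `v(μ) ≠ 0` and letting `u` run through the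
dense set of common functions, orthogonality says that `M_φ k₁(·, μ)a` is `k₁(·, μ)` times a fixed
vector. So `φ(x) = φ(μ)` whenever `k₁(x, μ) ≠ 0` (`multiplier_apply_eq_of_kernel_ne_zero`), which
makes `φ` constant on the equivalence classes, and comparing norms shows that `φ(μ)` is isometric
(`norm_multiplier_apply`). The argument needs a nonzero `b : E₂`; if `E₂ = 0`, the norm hypothesis
for the constant multiplier `1` forces `E₁ = 0` unless `Λ` is empty.
-/

namespace KernelFactorization

/-! ### Isometries out of a reproducing kernel Hilbert space -/

section Isometries

variable {X V : Type*} [NormedAddCommGroup V] [InnerProductSpace ℂ V] [CompleteSpace V]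
  {H : Type*} [NormedAddCommGroup H] [InnerProductSpace ℂ H] [RKHS ℂ H X V] [CompleteSpace H]
  {T : Type*} [NormedAddCommGroup T] [InnerProductSpace ℂ T] [CompleteSpace T]

/-- Vectors `Ψ x v` with the same inner products as the kernel functions define an isometry, because
the kernel functions span a dense subspace. -/
theorem exists_linearIsometry_apply_kerFun (Ψ : X → V →L[ℂ] T)
    (hΨ : ∀ x y v w, inner ℂ (Ψ y v) (Ψ x w) = inner ℂ (RKHS.kernel H x y v) w) :
    ∃ J : H →ₗᵢ[ℂ] T, ∀ x v, J (RKHS.kerFun H x v) = Ψ x v := by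
  let e : (X →₀ V) →ₗ[ℂ] H := Finsupp.lsum ℂ fun x => (RKHS.kerFun H x).toLinearMap
  let f : (X →₀ V) →ₗ[ℂ] T := Finsupp.lsum ℂ fun x => (Ψ x).toLinearMap
  have he : ∀ x v, e (Finsupp.single x v) = RKHS.kerFun H x v := fun x v => by simp [e]
  have hf : ∀ x v, f (Finsupp.single x v) = Ψ x v := fun x v => by simp [f]
  have hinner : ∀ z z', inner ℂ (f z) (f z') = inner ℂ (e z) (e z') := by
    intro z z'
    induction z using Finsupp.induction_linear with
    | zero => simp
    | add a b ha hb => simp only [map_add, inner_add_left, ha, hb]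
    | single y v =>
      induction z' using Finsupp.induction_linear with
      | zero => simp
      | add a b ha hb => simp only [map_add, inner_add_right, ha, hb]
      | single x w => rw [he, he, hf, hf, hΨ, RKHS.kernel_inner]
  have hnorm : ∀ z, ‖f z‖ = ‖e z‖ := fun z => by
    rw [@norm_eq_sqrt_re_inner ℂ, @norm_eq_sqrt_re_inner ℂ, hinner]
  have hdense : DenseRange e := by
    have hspan : Submodule.span ℂ {h | ∃ x v, RKHS.kerFun H x v = h} ≤ LinearMap.range e := by
      rw [Submodule.span_le]
      rintro _ ⟨x, v, rfl⟩
      exact ⟨_, he x v⟩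
    have htop : (LinearMap.range e).topologicalClosure = ⊤ :=
      top_unique ((RKHS.kerFun_dense H).ge.trans (Submodule.topologicalClosure_mono hspan))
    have := Submodule.dense_iff_topologicalClosure_eq_top.mpr htop
    rwa [LinearMap.coe_range] at this
  have hle : ∃ C : ℝ, ∀ z, ‖f z‖ ≤ C * ‖e z‖ := ⟨1, fun z => by rw [one_mul, hnorm]⟩
  have hext : ∀ z, f.extendOfNorm e (e z) = f z := LinearMap.extendOfNorm_eq hdense hle
  refine ⟨⟨(f.extendOfNorm e).toLinearMap, fun h => ?_⟩, fun x v => ?_⟩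
  · refine hdense.induction_on (p := fun h => ‖f.extendOfNorm e h‖ = ‖h‖) h
      (isClosed_eq (by fun_prop) (by fun_prop)) fun z => ?_
    rw [hext, hnorm]
  · change f.extendOfNorm e (RKHS.kerFun H x v) = Ψ x v
    rw [← he, hext, hf]

/-- Where the adjoint of an isometry does not decrease the norm, it is inverted by the isometry:
the vector lies in the range. -/
theorem apply_adjoint_eq_self_of_norm_le (J : H →ₗᵢ[ℂ] T) {w : T}
    (hw : ‖w‖ ≤ ‖J.toContinuousLinearMap.adjoint w‖) :
    J (J.toContinuousLinearMap.adjoint w) = w := by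
  set g := J.toContinuousLinearMap.adjoint w
  have hg : inner ℂ (J g) w = inner ℂ g g :=
    (ContinuousLinearMap.adjoint_inner_right J.toContinuousLinearMap g w).symm
  have h := norm_sub_sq (𝕜 := ℂ) (J g) w
  rw [hg, inner_self_eq_norm_sq, J.norm_map] at h
  have : ‖J g - w‖ ^ 2 ≤ 0 := by
    rw [h]
    nlinarith [norm_nonneg w]
  rw [← sub_eq_zero, ← norm_eq_zero]
  exact pow_eq_zero_iff two_ne_zero |>.mp (le_antisymm this (sq_nonneg _))

end Isometries

/-! ### Hilbert tensor products of operators -/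

section Tensor

variable {E F : Type*} [NormedAddCommGroup E] [InnerProductSpace ℂ E]
  [NormedAddCommGroup F] [InnerProductSpace ℂ F]

theorem HilbertTensor.ext_inner_left {s t : HilbertTensor E F}
    (h : ∀ (a : E) (b : F), inner ℂ ((a ⊗ₜ[ℂ] b : E ⊗[ℂ] F) : HilbertTensor E F) s =
      inner ℂ ((a ⊗ₜ[ℂ] b : E ⊗[ℂ] F) : HilbertTensor E F) t) : s = t := by
  refine UniformSpace.Completion.denseRange_coe.eq_of_inner_right ℂ fun r => ?_
  induction r using TensorProduct.induction_on with
  | zero => rw [UniformSpace.Completion.coe_zero, inner_zero_left, inner_zero_left]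
  | add r r' hr hr' =>
    simp only [UniformSpace.Completion.coe_add, inner_add_left, hr, hr']
  | tmul a b => exact h a b

theorem HilbertTensor.inner_tmul (a c : E) (b d : F) :
    inner ℂ ((a ⊗ₜ[ℂ] b : E ⊗[ℂ] F) : HilbertTensor E F)
      ((c ⊗ₜ[ℂ] d : E ⊗[ℂ] F) : HilbertTensor E F) = inner ℂ a c * inner ℂ b d := by
  rw [UniformSpace.Completion.inner_coe, TensorProduct.inner_tmul]

theorem HilbertTensor.norm_tmul (a : E) (b : F) :
    ‖((a ⊗ₜ[ℂ] b : E ⊗[ℂ] F) : HilbertTensor E F)‖ = ‖a‖ * ‖b‖ := by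
  rw [UniformSpace.Completion.norm_coe, TensorProduct.norm_tmul]

variable {E' F' : Type*} [NormedAddCommGroup E'] [InnerProductSpace ℂ E']
  [NormedAddCommGroup F'] [InnerProductSpace ℂ F']

theorem opTensor_tmul (A : E →L[ℂ] E') (B : F →L[ℂ] F') (a : E) (b : F) :
    opTensor A B ((a ⊗ₜ[ℂ] b : E ⊗[ℂ] F) : HilbertTensor E F) =
      ((A a ⊗ₜ[ℂ] B b : E' ⊗[ℂ] F') : HilbertTensor E' F') := by
  rw [opTensor_coe, TensorProduct.mapL_tmul]

theorem norm_opTensor_linearIsometry (A : E →ₗᵢ[ℂ] E') (B : F →ₗᵢ[ℂ] F') (t : HilbertTensor E F) :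
    ‖opTensor A.toContinuousLinearMap B.toContinuousLinearMap t‖ = ‖t‖ := by
  induction t using UniformSpace.Completion.induction_on with
  | hp => exact isClosed_eq (by fun_prop) (by fun_prop)
  | ih t =>
    rw [opTensor_coe, UniformSpace.Completion.norm_coe, UniformSpace.Completion.norm_coe]
    rw [← TensorProduct.toContinuousLinearMap_mapIsometry]
    exact TensorProduct.norm_map A B t

theorem IsConstantIsometryOn.starId {Λ : Type*} {φ : Λ → E →L[ℂ] E} {S : Set Λ}
    (h : IsConstantIsometryOn φ S) :
    IsConstantIsometryOn (KernelFactorization.starId φ F) S := by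
  obtain ⟨W, hW⟩ := h
  refine ⟨⟨(opTensor W.toContinuousLinearMap
    (LinearIsometry.id (R := ℂ) (E := F)).toContinuousLinearMap).toLinearMap,
    norm_opTensor_linearIsometry W _⟩, fun x hx => ?_⟩
  ext t
  simp only [KernelFactorization.starId, hW x hx]
  rfl

end Tensor

/-! ### Restriction to the diagonal -/

section Diagonal

variable {X V₁ V₂ : Type*}
  [NormedAddCommGroup V₁] [InnerProductSpace ℂ V₁] [CompleteSpace V₁]
  [NormedAddCommGroup V₂] [InnerProductSpace ℂ V₂] [CompleteSpace V₂]
  {H₁ H₂ H : Type*}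
  [NormedAddCommGroup H₁] [InnerProductSpace ℂ H₁] [RKHS ℂ H₁ X V₁] [CompleteSpace H₁]
  [NormedAddCommGroup H₂] [InnerProductSpace ℂ H₂] [RKHS ℂ H₂ X V₂] [CompleteSpace H₂]
  [NormedAddCommGroup H] [InnerProductSpace ℂ H] [RKHS ℂ H X (HilbertTensor V₁ V₂)]
  [CompleteSpace H]

/-- If `H` has the kernel `K₁ * K₂`, it embeds isometrically into the Hilbert tensor product
of the spaces of `K₁` and `K₂`. -/
theorem exists_linearIsometry_hilbertTensor
    (hK : RKHS.kernel H = kernelStar (RKHS.kernel H₁) (RKHS.kernel H₂)) :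
    ∃ J : H →ₗᵢ[ℂ] HilbertTensor H₁ H₂, ∀ x ξ,
      J (RKHS.kerFun H x ξ) = opTensor (RKHS.kerFun H₁ x) (RKHS.kerFun H₂ x) ξ := by
  refine exists_linearIsometry_apply_kerFun
    (fun x => opTensor (RKHS.kerFun H₁ x) (RKHS.kerFun H₂ x)) fun x y v w => ?_
  rw [hK]
  induction v using UniformSpace.Completion.induction_on with
  | hp => exact isClosed_eq (by fun_prop) (by fun_prop)
  | ih s =>
    induction w using UniformSpace.Completion.induction_on with
    | hp => exact isClosed_eq (by fun_prop) (by fun_prop)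
    | ih t =>
      simp only [kernelStar, Matrix.of_apply, opTensor_coe, UniformSpace.Completion.inner_coe]
      induction s using TensorProduct.induction_on with
      | zero => simp
      | add s s' hs hs' => simp only [map_add, inner_add_left, hs, hs']
      | tmul a b =>
        induction t using TensorProduct.induction_on with
        | zero => simp
        | add t t' ht ht' => simp only [map_add, inner_add_right, ht, ht']
        | tmul c d =>
          rw [TensorProduct.mapL_tmul, TensorProduct.mapL_tmul, TensorProduct.mapL_tmul,
            TensorProduct.inner_tmul, TensorProduct.inner_tmul, RKHS.kernel_inner,
            RKHS.kernel_inner]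

variable {J : H →ₗᵢ[ℂ] HilbertTensor H₁ H₂}
  (hJ : ∀ x ξ, J (RKHS.kerFun H x ξ) = opTensor (RKHS.kerFun H₁ x) (RKHS.kerFun H₂ x) ξ)

include hJ

/-- The adjoint of the canonical embedding restricts a function of two variables to the
diagonal. -/
theorem adjoint_tmul_apply (u : H₁) (v : H₂) (x : X) :
    J.toContinuousLinearMap.adjoint ((u ⊗ₜ[ℂ] v : H₁ ⊗[ℂ] H₂) : HilbertTensor H₁ H₂) x =
      ((u x ⊗ₜ[ℂ] v x : V₁ ⊗[ℂ] V₂) : HilbertTensor V₁ V₂) := by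
  refine HilbertTensor.ext_inner_left fun a b => ?_
  rw [← RKHS.kerFun_inner, ContinuousLinearMap.adjoint_inner_right,
    LinearIsometry.coe_toContinuousLinearMap, hJ, opTensor_tmul, HilbertTensor.inner_tmul,
    HilbertTensor.inner_tmul, RKHS.kerFun_inner, RKHS.kerFun_inner]

/-- Elementary tensors with the same restriction to the diagonal have the same inner products
with the range of the canonical embedding. -/
theorem inner_tmul_eq_of_diagonal_eq {u u' : H₁} {v v' : H₂}
    (h : ∀ x, u x ⊗ₜ[ℂ] v x = u' x ⊗ₜ[ℂ] v' x) (g : H) :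
    inner ℂ ((u ⊗ₜ[ℂ] v : H₁ ⊗[ℂ] H₂) : HilbertTensor H₁ H₂) (J g) =
      inner ℂ ((u' ⊗ₜ[ℂ] v' : H₁ ⊗[ℂ] H₂) : HilbertTensor H₁ H₂) (J g) := by
  have : J.toContinuousLinearMap.adjoint ((u ⊗ₜ[ℂ] v : H₁ ⊗[ℂ] H₂) : HilbertTensor H₁ H₂) =
      J.toContinuousLinearMap.adjoint ((u' ⊗ₜ[ℂ] v' : H₁ ⊗[ℂ] H₂) : HilbertTensor H₁ H₂) := by
    ext x
    rw [adjoint_tmul_apply hJ, adjoint_tmul_apply hJ, h]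
  rw [← LinearIsometry.coe_toContinuousLinearMap, ← ContinuousLinearMap.adjoint_inner_left,
    this, ContinuousLinearMap.adjoint_inner_left]

/-- If `M_φ` is a contraction and `M_{φ * I}` is an isometry, the canonical embedding intertwines
`M_{φ * I}` and `M_φ ⊗ I` on the kernel functions. -/
theorem apply_mulOp_kerFun_of_isometry {φ : X → V₁ →L[ℂ] V₁} (hφ : IsMultiplier H₁ H₁ φ)
    (hφI : IsMultiplier H H (starId φ V₂)) (hnorm : ‖hφ.mulOp‖ ≤ 1) (hiso : Isometry hφI.mulOp)
    (x : X) (a : V₁) (b : V₂) :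
    J (hφI.mulOp (RKHS.kerFun H x ((a ⊗ₜ[ℂ] b : V₁ ⊗[ℂ] V₂) : HilbertTensor V₁ V₂))) =
      ((hφ.mulOp (RKHS.kerFun H₁ x a) ⊗ₜ[ℂ] RKHS.kerFun H₂ x b : H₁ ⊗[ℂ] H₂) :
        HilbertTensor H₁ H₂) := by
  set κ := RKHS.kerFun H x ((a ⊗ₜ[ℂ] b : V₁ ⊗[ℂ] V₂) : HilbertTensor V₁ V₂) with hκ
  have hJκ : J κ = ((RKHS.kerFun H₁ x a ⊗ₜ[ℂ] RKHS.kerFun H₂ x b : H₁ ⊗[ℂ] H₂) :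
      HilbertTensor H₁ H₂) := by
    rw [hκ, hJ, opTensor_tmul]
  have hadj : J.toContinuousLinearMap.adjoint (J κ) = κ := by
    refine ext_inner_left ℂ fun g => ?_
    rw [ContinuousLinearMap.adjoint_inner_right]
    exact J.inner_map_map g κ
  have hM : J.toContinuousLinearMap.adjoint
      ((hφ.mulOp (RKHS.kerFun H₁ x a) ⊗ₜ[ℂ] RKHS.kerFun H₂ x b : H₁ ⊗[ℂ] H₂) :
        HilbertTensor H₁ H₂) = hφI.mulOp κ := by
    ext y
    rw [adjoint_tmul_apply hJ, hφI.mulOp_apply]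
    conv_rhs => rw [← hadj, hJκ, adjoint_tmul_apply hJ]
    rw [starId, opTensor_tmul, hφ.mulOp_apply, ContinuousLinearMap.id_apply]
  rw [← hM]
  refine apply_adjoint_eq_self_of_norm_le J ?_
  rw [hM, (AddMonoidHomClass.isometry_iff_norm hφI.mulOp).mp hiso κ, ← J.norm_map, hJκ,
    HilbertTensor.norm_tmul, HilbertTensor.norm_tmul]
  gcongr
  exact (hφ.mulOp.le_of_opNorm_le hnorm _).trans_eq (one_mul _)

end Diagonal

/-! ### Quasiscalar kernels -/

section Quasiscalar

variable {Λ : Type*} {k : Matrix Λ Λ ℂ} [hk : Fact k.PosSemidef]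
  {E : Type*} [NormedAddCommGroup E] [InnerProductSpace ℂ E] [CompleteSpace E]

theorem kerFun_quasiscalar_apply (y x : Λ) (a : E) :
    RKHS.kerFun (RKHS.OfKernel (quasiscalar k E)) y a x = k x y • a := by
  rw [RKHS.kerFun_apply, RKHS.OfKernel.kernel_ofKernel]
  rfl

theorem star_kernel_apply (x y : Λ) : star (k x y) = k y x :=
  hk.out.isHermitian.apply y x

theorem inner_kerFun_quasiscalar (x y : Λ) (a b : E) :
    inner ℂ (RKHS.kerFun (RKHS.OfKernel (quasiscalar k E)) x a)
      (RKHS.kerFun (RKHS.OfKernel (quasiscalar k E)) y b) = k x y * inner ℂ a b := by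
  rw [RKHS.kerFun_inner, kerFun_quasiscalar_apply, inner_smul_right]

theorem norm_kerFun_quasiscalar (x : Λ) (a : E) :
    ‖RKHS.kerFun (RKHS.OfKernel (quasiscalar k E)) x a‖ = √(k x x).re * ‖a‖ := by
  have him : (k x x).im = 0 := by
    have := star_kernel_apply (k := k) x x
    exact Complex.conj_eq_iff_im.mp this
  rw [@norm_eq_sqrt_re_inner ℂ, inner_kerFun_quasiscalar, inner_self_eq_norm_sq_to_K,
    ← Real.sqrt_sq (norm_nonneg a), ← Real.sqrt_mul' _ (sq_nonneg _), Real.sqrt_sq (norm_nonneg a)]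
  congr 1
  have : ((‖a‖ : ℂ) ^ 2) = ((‖a‖ ^ 2 : ℝ) : ℂ) := by push_cast; rfl
  simp only [Complex.coe_algebraMap, this, RCLike.re_to_complex, Complex.mul_re,
    Complex.ofReal_re, Complex.ofReal_im, mul_zero, sub_zero]

/-- A point at which some function of the scalar space does not vanish has `k(x, x) > 0`. -/
theorem sqrt_kernel_diag_ne_zero {x : Λ} (u : RKHS.OfKernel (quasiscalar k ℂ)) (hu : u x ≠ 0) :
    √(k x x).re ≠ 0 := by
  intro h
  have h0 : RKHS.kerFun (RKHS.OfKernel (quasiscalar k ℂ)) x (1 : ℂ) = 0 := by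
    rw [← norm_eq_zero, norm_kerFun_quasiscalar, h, zero_mul]
  have := RKHS.kerFun_inner x (1 : ℂ) u
  rw [h0, inner_zero_left] at this
  apply hu
  simpa using this.symm

/-- The map `u ↦ u a` from the space of `k` to the space of `k I_E`, for a vector `a : E`. -/
theorem exists_continuousLinearMap_apply_eq_smul (a : E) :
    ∃ L : RKHS.OfKernel (quasiscalar k ℂ) →L[ℂ] RKHS.OfKernel (quasiscalar k E),
      ∀ u x, L u x = u x • a := by
  rcases eq_or_ne a 0 with rfl | ha
  · exact ⟨0, fun u x => by simp⟩
  -- For a unit vector the map is an isometry; the general case follows by scaling.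
  set e : E := ((‖a‖⁻¹ : ℝ) : ℂ) • a with he
  have hne : ((‖a‖ : ℝ) : ℂ) ≠ 0 := by simpa using ha
  have hae : ((‖a‖ : ℝ) : ℂ) • e = a := by
    rw [he, smul_smul, Complex.ofReal_inv, mul_inv_cancel₀ hne, one_smul]
  have hnorm : ‖e‖ = 1 := by
    rw [he, norm_smul, Complex.norm_real, norm_inv, norm_norm,
      inv_mul_cancel₀ (norm_ne_zero_iff.mpr ha)]
  obtain ⟨J, hJ⟩ := exists_linearIsometry_apply_kerFun
    (H := RKHS.OfKernel (quasiscalar k ℂ)) (T := RKHS.OfKernel (quasiscalar k E))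
    (fun x => (RKHS.kerFun (RKHS.OfKernel (quasiscalar k E)) x).comp
      ((ContinuousLinearMap.id ℂ ℂ).smulRight e)) fun x y v w => by
        rw [RKHS.kernel_inner, inner_kerFun_quasiscalar]
        simp only [ContinuousLinearMap.comp_apply, ContinuousLinearMap.smulRight_apply,
          ContinuousLinearMap.id_apply]
        rw [inner_kerFun_quasiscalar, inner_smul_left, inner_smul_right,
          inner_self_eq_norm_sq_to_K, hnorm]
        simp [mul_comm]
  -- By density and continuity it suffices to check the formula on kernel functions.
  have hJapply : ∀ u x, J u x = u x • e := by
    intro u x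
    have hclosed : IsClosed {u : RKHS.OfKernel (quasiscalar k ℂ) | J u x = u x • e} :=
      isClosed_eq ((RKHS.continuous_eval x).comp J.continuous)
        ((RKHS.continuous_eval x).smul continuous_const)
    have hdense := RKHS.kerFun_dense (RKHS.OfKernel (quasiscalar k ℂ))
    have hu : u ∈ closure (Submodule.span ℂ
        {h | ∃ x v, RKHS.kerFun (RKHS.OfKernel (quasiscalar k ℂ)) x v = h} : Set _) := by
      rw [← Submodule.topologicalClosure_coe, hdense]
      trivial
    refine closure_minimal (fun h hh => ?_) hclosed hu
    change J h x = h x • e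
    induction hh using Submodule.span_induction with
    | mem h hh =>
      obtain ⟨y, v, rfl⟩ := hh
      rw [hJ]
      simp only [ContinuousLinearMap.comp_apply, ContinuousLinearMap.smulRight_apply,
          ContinuousLinearMap.id_apply]
      rw [kerFun_quasiscalar_apply, kerFun_quasiscalar_apply, smul_smul, smul_eq_mul]
    | zero => simp
    | add p q _ _ hp hq => simp [hp, hq, add_smul]
    | smul c p _ hp => simp [hp, smul_smul]
  refine ⟨((‖a‖ : ℝ) : ℂ) • J.toContinuousLinearMap, fun u x => ?_⟩
  rw [_root_.smul_apply, LinearIsometry.coe_toContinuousLinearMap, RKHS.coe_smul,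
    Pi.smul_apply, hJapply, smul_comm, hae]

end Quasiscalar

/-! ### Rigidity of isometric multipliers -/

section Rigidity

variable {Λ E₁ E₂ : Type*}
  [NormedAddCommGroup E₁] [InnerProductSpace ℂ E₁] [CompleteSpace E₁]
  [NormedAddCommGroup E₂] [InnerProductSpace ℂ E₂] [CompleteSpace E₂]
  {k₁ k₂ : Matrix Λ Λ ℂ} [Fact k₁.PosSemidef] [Fact k₂.PosSemidef]

/-- If all common functions vanished at `μ`, so would every function in the space of `k₁`, among
them the kernel functions, and then `k₁(·, μ) = 0`. -/
theorem exists_common_function_ne_zero (hk₁ : ∀ μ, (fun x => k₁ x μ) ≠ 0)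
    (hdense : Dense {f : RKHS.OfKernel (quasiscalar k₁ ℂ) |
      ∃ g : RKHS.OfKernel (quasiscalar k₂ ℂ), ∀ x, g x = f x}) (μ : Λ) :
    ∃ (v : RKHS.OfKernel (quasiscalar k₁ ℂ)) (w : RKHS.OfKernel (quasiscalar k₂ ℂ)),
      (∀ x, w x = v x) ∧ v μ ≠ 0 := by
  by_contra! hcon
  have hzero : ∀ u : RKHS.OfKernel (quasiscalar k₁ ℂ), u μ = 0 := by
    intro u
    refine hdense.induction (P := fun u => u μ = 0) ?_
      (isClosed_eq (RKHS.continuous_eval μ) continuous_const) u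
    rintro v ⟨w, hw⟩
    exact hcon v w hw
  refine hk₁ μ (funext fun x => ?_)
  have := hzero (RKHS.kerFun _ x 1)
  rw [kerFun_quasiscalar_apply, smul_eq_mul, mul_one] at this
  change k₁ x μ = 0
  rw [← star_kernel_apply (k := k₁), this, star_zero]

variable {φ : Λ → E₁ →L[ℂ] E₁}
  (hφ : IsMultiplier (RKHS.OfKernel (quasiscalar k₁ E₁)) (RKHS.OfKernel (quasiscalar k₁ E₁)) φ)
  (hφI : IsMultiplier
    (RKHS.OfKernel (kernelStar (quasiscalar k₁ E₁) (quasiscalar k₂ E₂)))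
    (RKHS.OfKernel (kernelStar (quasiscalar k₁ E₁) (quasiscalar k₂ E₂))) (starId φ E₂))

include hφI in
/-- The functions `u c ⊗ w b` and `v c ⊗ z b` of two variables, with `z = u` and `w = v` as
functions, agree on the diagonal, so they have the same inner product with
`M_φ k₁(·, μ) a ⊗ k₂(·, μ) b`. Letting `u` vary shows that `M_φ k₁(·, μ) a` is `k₁(·, μ)` times a
vector; at a point `x` with `k₁(x, μ) ≠ 0` this vector is `φ x a`, and at `μ` it is `φ μ a`. -/
theorem multiplier_apply_eq_of_kernel_ne_zero [Nontrivial E₂]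
    (hk₁ : ∀ μ, (fun x => k₁ x μ) ≠ 0)
    (hdense : Dense {f : RKHS.OfKernel (quasiscalar k₁ ℂ) |
      ∃ g : RKHS.OfKernel (quasiscalar k₂ ℂ), ∀ x, g x = f x})
    (hnorm : ‖hφ.mulOp‖ ≤ 1) (hiso : Isometry hφI.mulOp) {x μ : Λ} (hx : k₁ x μ ≠ 0) :
    φ x = φ μ := by
  obtain ⟨b, hb⟩ := exists_ne (0 : E₂)
  obtain ⟨v, w, hwv, hvμ⟩ := exists_common_function_ne_zero hk₁ hdense μ
  have hμ : k₁ μ μ ≠ 0 := fun h => sqrt_kernel_diag_ne_zero v hvμ (by simp [h])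
  obtain ⟨J, hJ⟩ := exists_linearIsometry_hilbertTensor
    (H₁ := RKHS.OfKernel (quasiscalar k₁ E₁)) (H₂ := RKHS.OfKernel (quasiscalar k₂ E₂))
    (H := RKHS.OfKernel (kernelStar (quasiscalar k₁ E₁) (quasiscalar k₂ E₂)))
    (by simp only [RKHS.OfKernel.kernel_ofKernel])
  obtain ⟨R, hR⟩ := exists_continuousLinearMap_apply_eq_smul (k := k₂) b
  ext a
  refine ext_inner_left ℂ fun c => ?_
  obtain ⟨L, hL⟩ := exists_continuousLinearMap_apply_eq_smul (k := k₁) c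
  set f := hφ.mulOp (RKHS.kerFun (RKHS.OfKernel (quasiscalar k₁ E₁)) μ a) with hf
  have hbb : inner ℂ b b ≠ 0 := inner_self_ne_zero.mpr hb
  have hcommon : ∀ (u : RKHS.OfKernel (quasiscalar k₁ ℂ)),
      (∃ z : RKHS.OfKernel (quasiscalar k₂ ℂ), ∀ x, z x = u x) →
      inner ℂ (L u) f * star (v μ) = inner ℂ (L v) f * star (u μ) := by
    rintro u ⟨z, hz⟩
    have h := inner_tmul_eq_of_diagonal_eq hJ (u := L u) (v := R w) (u' := L v) (v' := R z)
      (fun y => by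
        rw [hL, hR, hL, hR, hwv, hz, TensorProduct.smul_tmul_smul,
          TensorProduct.smul_tmul_smul, mul_comm])
      (hφI.mulOp (RKHS.kerFun _ μ ((a ⊗ₜ[ℂ] b : E₁ ⊗[ℂ] E₂) : HilbertTensor E₁ E₂)))
    rw [apply_mulOp_kerFun_of_isometry hJ hφ hφI hnorm hiso, HilbertTensor.inner_tmul,
      HilbertTensor.inner_tmul, RKHS.inner_kerFun, RKHS.inner_kerFun, hR, hR, hwv, hz,
      inner_smul_left, inner_smul_left, ← mul_assoc, ← mul_assoc] at h
    exact mul_right_cancel₀ hbb h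
  have hall : ∀ u : RKHS.OfKernel (quasiscalar k₁ ℂ),
      inner ℂ (L u) f * star (v μ) = inner ℂ (L v) f * star (u μ) := by
    intro u
    refine hdense.induction
      (P := fun u => inner ℂ (L u) f * star (v μ) = inner ℂ (L v) f * star (u μ)) hcommon ?_ u
    have := RKHS.continuous_eval (𝕜 := ℂ) (H := RKHS.OfKernel (quasiscalar k₁ ℂ)) μ
    exact isClosed_eq (by fun_prop) (continuous_const.mul this.star)
  have hker : ∀ y, k₁ y μ ≠ 0 → inner ℂ c (φ y a) * star (v μ) = inner ℂ (L v) f := by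
    intro y hy
    have hLk : L (RKHS.kerFun _ y 1) = RKHS.kerFun _ y c := by
      ext s
      rw [hL, kerFun_quasiscalar_apply, kerFun_quasiscalar_apply, smul_eq_mul, mul_one]
    have h := hall (RKHS.kerFun _ y 1)
    rw [hLk, RKHS.kerFun_inner, hf, hφ.mulOp_apply, kerFun_quasiscalar_apply,
      kerFun_quasiscalar_apply, smul_eq_mul, mul_one, star_kernel_apply, map_smul,
      inner_smul_right, ← hf] at h
    refine mul_left_cancel₀ hy ?_
    rw [← mul_assoc, h, mul_comm]
  exact mul_right_cancel₀ (star_ne_zero.mpr hvμ) ((hker x hx).trans (hker μ hμ).symm)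

include hφI in
/-- Since `M_φ k₁(·, μ) a = k₁(·, μ) φ(μ) a`, the isometry property on `k₁(·, μ) a ⊗ k₂(·, μ) b`
reads `‖φ(μ) a‖ = ‖a‖`. -/
theorem norm_multiplier_apply [Nontrivial E₂]
    (hk₁ : ∀ μ, (fun x => k₁ x μ) ≠ 0)
    (hdense : Dense {f : RKHS.OfKernel (quasiscalar k₁ ℂ) |
      ∃ g : RKHS.OfKernel (quasiscalar k₂ ℂ), ∀ x, g x = f x})
    (hnorm : ‖hφ.mulOp‖ ≤ 1) (hiso : Isometry hφI.mulOp) (μ : Λ) (a : E₁) :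
    ‖φ μ a‖ = ‖a‖ := by
  obtain ⟨b, hb⟩ := exists_ne (0 : E₂)
  obtain ⟨v, w, hwv, hvμ⟩ := exists_common_function_ne_zero hk₁ hdense μ
  have h₁ := sqrt_kernel_diag_ne_zero v hvμ
  have h₂ := sqrt_kernel_diag_ne_zero w (by rwa [hwv])
  obtain ⟨J, hJ⟩ := exists_linearIsometry_hilbertTensor
    (H₁ := RKHS.OfKernel (quasiscalar k₁ E₁)) (H₂ := RKHS.OfKernel (quasiscalar k₂ E₂))
    (H := RKHS.OfKernel (kernelStar (quasiscalar k₁ E₁) (quasiscalar k₂ E₂)))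
    (by simp only [RKHS.OfKernel.kernel_ofKernel])
  have hM : hφ.mulOp (RKHS.kerFun _ μ a) = RKHS.kerFun _ μ (φ μ a) := by
    ext y
    rw [hφ.mulOp_apply, kerFun_quasiscalar_apply, kerFun_quasiscalar_apply, map_smul]
    rcases eq_or_ne (k₁ y μ) 0 with hy | hy
    · rw [hy, zero_smul, zero_smul]
    · rw [multiplier_apply_eq_of_kernel_ne_zero hφ hφI hk₁ hdense hnorm hiso hy]
  have h := congrArg norm (apply_mulOp_kerFun_of_isometry hJ hφ hφI hnorm hiso μ a b)
  rw [J.norm_map, (AddMonoidHomClass.isometry_iff_norm hφI.mulOp).mp hiso, ← J.norm_map, hJ,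
    opTensor_tmul, HilbertTensor.norm_tmul, HilbertTensor.norm_tmul, hM,
    norm_kerFun_quasiscalar, norm_kerFun_quasiscalar, norm_kerFun_quasiscalar] at h
  have hb' := norm_ne_zero_iff.mpr hb
  exact (mul_left_cancel₀ h₁ (mul_right_cancel₀ (mul_ne_zero h₂ hb') h)).symm

/-- For `E₂ = 0` the space of `K₁ * K₂` is zero, and the norm equality for the constant multiplier
`1` forces `E₁ = 0`. -/
theorem subsingleton_left_of_subsingleton_right [Subsingleton E₂] [Nonempty Λ]
    (hk₁ : ∀ μ, (fun x => k₁ x μ) ≠ 0)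
    (hnorm : ∀ (ψ : Λ → E₁ →L[ℂ] E₁)
      (hψ : IsMultiplier (RKHS.OfKernel (quasiscalar k₁ E₁)) (RKHS.OfKernel (quasiscalar k₁ E₁)) ψ)
      (hψI : IsMultiplier
        (RKHS.OfKernel (kernelStar (quasiscalar k₁ E₁) (quasiscalar k₂ E₂)))
        (RKHS.OfKernel (kernelStar (quasiscalar k₁ E₁) (quasiscalar k₂ E₂))) (starId ψ E₂)),
      ‖hψI.mulOp‖ = ‖hψ.mulOp‖) : Subsingleton E₁ := by
  have hT : ∀ t : HilbertTensor E₁ E₂, t = 0 := fun t =>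
    HilbertTensor.ext_inner_left fun a b => by
      rw [Subsingleton.elim b 0, TensorProduct.tmul_zero, UniformSpace.Completion.coe_zero,
        inner_zero_left, inner_zero_left]
  have hψ : IsMultiplier (RKHS.OfKernel (quasiscalar k₁ E₁)) (RKHS.OfKernel (quasiscalar k₁ E₁))
      (fun _ => ContinuousLinearMap.id ℂ E₁) := fun f => ⟨f, fun _ => rfl⟩
  have hψI : IsMultiplier
      (RKHS.OfKernel (kernelStar (quasiscalar k₁ E₁) (quasiscalar k₂ E₂)))
      (RKHS.OfKernel (kernelStar (quasiscalar k₁ E₁) (quasiscalar k₂ E₂)))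
      (starId (fun _ => ContinuousLinearMap.id ℂ E₁) E₂) :=
    fun f => ⟨f, fun x => (hT _).trans (hT _).symm⟩
  have hzero : hψI.mulOp = 0 := by
    ext f x
    exact (hT _).trans (hT _).symm
  have hψzero : hψ.mulOp = 0 := by
    rw [← norm_eq_zero, ← hnorm _ hψ hψI, hzero, norm_zero]
  refine subsingleton_of_forall_eq 0 fun a => ?_
  obtain ⟨μ⟩ := ‹Nonempty Λ›
  obtain ⟨x, hx⟩ := Function.ne_iff.mp (hk₁ μ)
  have h := hψ.mulOp_apply (RKHS.kerFun _ μ a) x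
  rw [hψzero, _root_.zero_apply, RKHS.coe_zero, Pi.zero_apply,
    ContinuousLinearMap.id_apply, kerFun_quasiscalar_apply] at h
  exact (smul_eq_zero.mp h.symm).resolve_left hx

end Rigidity

end KernelFactorization

open KernelFactorization in
theorem mainTheorem1 {Λ E₁ E₂ : Type*}
    [NormedAddCommGroup E₁] [InnerProductSpace ℂ E₁] [CompleteSpace E₁]
    [NormedAddCommGroup E₂] [InnerProductSpace ℂ E₂] [CompleteSpace E₂]
    (k₁ k₂ : Matrix Λ Λ ℂ) [Fact k₁.PosSemidef] [Fact k₂.PosSemidef]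
    (hk₁ : ∀ μ, (fun x => k₁ x μ) ≠ 0)
    (hnorm : ∀ (ψ : Λ → E₁ →L[ℂ] E₁)
      (hψ : IsMultiplier (RKHS.OfKernel (quasiscalar k₁ E₁)) (RKHS.OfKernel (quasiscalar k₁ E₁)) ψ)
      (hψI : IsMultiplier
        (RKHS.OfKernel (kernelStar (quasiscalar k₁ E₁) (quasiscalar k₂ E₂)))
        (RKHS.OfKernel (kernelStar (quasiscalar k₁ E₁) (quasiscalar k₂ E₂))) (starId ψ E₂)),
      ‖hψI.mulOp‖ = ‖hψ.mulOp‖)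
    (hdense : Dense {f : RKHS.OfKernel (quasiscalar k₁ ℂ) |
      ∃ g : RKHS.OfKernel (quasiscalar k₂ ℂ), ∀ x, g x = f x})
    (φ : Λ → E₁ →L[ℂ] E₁)
    (hφ : IsMultiplier (RKHS.OfKernel (quasiscalar k₁ E₁)) (RKHS.OfKernel (quasiscalar k₁ E₁)) φ)
    (hφI : IsMultiplier
      (RKHS.OfKernel (kernelStar (quasiscalar k₁ E₁) (quasiscalar k₂ E₂)))
      (RKHS.OfKernel (kernelStar (quasiscalar k₁ E₁) (quasiscalar k₂ E₂))) (starId φ E₂))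
    (hiso : Isometry hφI.mulOp) :
    (∀ S ∈ (kernelSetoid k₁).classes,
      IsConstantIsometryOn φ S ∧ IsConstantIsometryOn (starId φ E₂) S) ∧
    ((∀ x y, k₁ x y ≠ 0) →
      (∀ x y, (kernelSetoid k₁) x y) ∧
      IsConstantIsometryOn φ Set.univ ∧ IsConstantIsometryOn (starId φ E₂) Set.univ) := by
  have hrigid : (∀ x μ, k₁ x μ ≠ 0 → φ x = φ μ) ∧ ∀ μ a, ‖φ μ a‖ = ‖a‖ := by
    rcases subsingleton_or_nontrivial E₂ with _ | _
    · have hE : Nonempty Λ → Subsingleton E₁ := fun _ =>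
        subsingleton_left_of_subsingleton_right hk₁ hnorm
      refine ⟨fun x μ _ => ?_, fun μ a => ?_⟩
      · have := hE ⟨x⟩
        exact Subsingleton.elim _ _
      · have := hE ⟨μ⟩
        rw [Subsingleton.elim (φ μ a) a]
    · have hle : ‖hφ.mulOp‖ ≤ 1 := by
        rw [← hnorm φ hφ hφI]
        refine ContinuousLinearMap.opNorm_le_bound _ zero_le_one fun f => ?_
        rw [(AddMonoidHomClass.isometry_iff_norm hφI.mulOp).mp hiso f, one_mul]
      exact ⟨fun x μ hx => multiplier_apply_eq_of_kernel_ne_zero hφ hφI hk₁ hdense hle hiso hx,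
        norm_multiplier_apply hφ hφI hk₁ hdense hle hiso⟩
  obtain ⟨hconst, hisom⟩ := hrigid
  refine ⟨fun S hS => ?_, fun hne => ⟨fun x y => Relation.ReflTransGen.single (hne x y), ?_⟩⟩
  · obtain ⟨μ, rfl⟩ := hS
    have h : IsConstantIsometryOn φ {x | (kernelSetoid k₁) x μ} := by
      refine ⟨⟨(φ μ).toLinearMap, hisom μ⟩, fun x hx => ?_⟩
      have hφx : φ x = φ μ := by
        change Relation.ReflTransGen _ x μ at hx
        induction hx with
        | refl => rfl
        | tail _ hbc ih => exact ih.trans (hconst _ _ hbc)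
      rw [hφx]
      rfl
    exact ⟨h, h.starId⟩
  · have h : IsConstantIsometryOn φ Set.univ := by
      rcases isEmpty_or_nonempty Λ with _ | ⟨⟨μ⟩⟩
      · exact ⟨LinearIsometry.id, fun x => isEmptyElim x⟩
      · refine ⟨⟨(φ μ).toLinearMap, hisom μ⟩, fun x _ => ?_⟩
        rw [hconst x μ (hne x μ)]
        rfl
    exact ⟨h, h.starId⟩
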